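/- Let $K$ be an algebraically closed field, $Q$ a finite connected quiver in which at most two arrows start and at most two arrows end at each vertex, and $I$ an admissible ideal of the path algebra $KQ$ (that is, $R^m\subseteq I\subseteq R^2$ for some $m\ge 2$, where $R$ is the ideal generated by the arrows). Paths are composed from left to right. Suppose that $\Lambda=KQ/I$ is a tame symmetric algebra which is periodic of period four, i.e. $4$ is the smallest $d\ge 1$ with $\Omega^d_{\Lambda^e}(\Lambda)\cong\Lambda$ as $\Lambda$-bimodules. A minimal relation (minimal generator of $I$) from a vertex $a$ to a vertex $b$ is an element $\rho\in e_aIe_b$ (a linear combination of paths from $a$ to $b$ lying in $I$) with $\rho\notin IR+RI$. For a path $p$ in $Q$ write $p\prec I$ if $p$ occurs with nonzero coefficient in some minimal relation. Let $$u\stackrel{\delta}\longrightarrow i\stackrel{\alpha}\longrightarrow k\stackrel{\beta}\longrightarrow t\stackrel{\gamma}\longrightarrow j$$ be arrows of $Q$ (the vertices need not be distinct). If $\alpha\beta\not\prec I$ or $\beta\gamma\not\prec I$, and $\alpha\beta\gamma\prec I$, then there is an arrow $j\to i$ in $Q$; thus $\alpha,\beta,\gamma$ together with this arrow form a square in $Q$.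 -/

import Mathlib

open scoped TensorProduct Polynomial

noncomputable section

universe u v w

/-! ### Path algebras -/

/-- All paths of a quiver, including the path of length zero at each vertex. -/
abbrev QPath (V : Type u) [Quiver.{v} V] : Type (max u v) :=
  Σ a b : V, Quiver.Path a b

/-- The underlying vector space of the path algebra `KQ`: the paths form a `K`-basis. -/
def PathAlgebra (K : Type w) [Field K] (V : Type u) [Quiver.{v} V] : Type (max u v w) :=
  QPath V →₀ K

namespace PathAlgebra

variable {K : Type w} [Field K] {V : Type u} [Quiver.{v} V]

instance : AddCommGroup (PathAlgebra K V) := inferInstanceAs (AddCommGroup (QPath V →₀ K))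

instance : Module K (PathAlgebra K V) := inferInstanceAs (Module K (QPath V →₀ K))

/-- The coefficient of the path `p` in `x`. -/
def coeff (x : PathAlgebra K V) {a b : V} (p : Quiver.Path a b) : K :=
  (show QPath V →₀ K from x) ⟨a, b, p⟩

variable (K) in
/-- A path, as an element of the path algebra. -/
def ofPath {a b : V} (p : Quiver.Path a b) : PathAlgebra K V :=
  Finsupp.single (⟨a, b, p⟩ : QPath V) (1 : K)

open Classical in
variable (K) in
/-- Product of two paths, written from left to right: `p q` is `p` followed by `q` if `p` ends
where `q` starts, and `0` otherwise. -/
def pathMul (p q : QPath V) : PathAlgebra K V :=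
  if h : p.2.1 = q.1 then ofPath K (p.2.2.comp (q.2.2.cast h.symm rfl)) else 0

variable (K V) in
/-- The bilinear extension of `pathMul`. -/
def mulHom : PathAlgebra K V →ₗ[K] PathAlgebra K V →ₗ[K] PathAlgebra K V :=
  Finsupp.linearCombination K fun p : QPath V =>
    (Finsupp.linearCombination K fun q : QPath V => pathMul K p q :
      (QPath V →₀ K) →ₗ[K] PathAlgebra K V)

instance : Mul (PathAlgebra K V) := ⟨fun x y => mulHom K V x y⟩

instance [Fintype V] : One (PathAlgebra K V) :=
  ⟨∑ a : V, ofPath K (Quiver.Path.nil : Quiver.Path a a)⟩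

theorem mul_def (x y : PathAlgebra K V) : x * y = mulHom K V x y := rfl

theorem ofPath_mul_ofPath {a b c d : V} (p : Quiver.Path a b) (q : Quiver.Path c d) :
    ofPath K p * ofPath K q = pathMul K ⟨a, b, p⟩ ⟨c, d, q⟩ := by
  rw [mul_def, mulHom, ofPath, ofPath]
  erw [Finsupp.linearCombination_single, one_smul]
  erw [Finsupp.linearCombination_single, one_smul]

theorem ofPath_mul_comp {a b c : V} (p : Quiver.Path a b) (q : Quiver.Path b c) :
    ofPath K p * ofPath K q = ofPath K (p.comp q) := by
  rw [ofPath_mul_ofPath, pathMul, dif_pos rfl]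
  rfl

theorem ofPath_mul_of_ne {a b c d : V} (p : Quiver.Path a b) (q : Quiver.Path c d) (h : b ≠ c) :
    ofPath K p * ofPath K q = 0 := by
  rw [ofPath_mul_ofPath, pathMul, dif_neg h]

theorem induction_on {P : PathAlgebra K V → Prop} (x : PathAlgebra K V) (h0 : P 0)
    (hadd : ∀ x y, P x → P y → P (x + y))
    (hp : ∀ (c : K) (a b : V) (p : Quiver.Path a b), P (c • ofPath K p)) : P x := by
  refine Finsupp.induction_linear (motive := fun x : QPath V →₀ K => P x) x h0 hadd ?_
  rintro ⟨a, b, p⟩ c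
  have := hp c a b p
  rw [ofPath] at this
  erw [Finsupp.smul_single, smul_eq_mul, mul_one] at this
  exact this

theorem add_mul_aux (x y z : PathAlgebra K V) : (x + y) * z = x * z + y * z := by
  simp only [mul_def, map_add, LinearMap.add_apply]

theorem mul_add_aux (x y z : PathAlgebra K V) : x * (y + z) = x * y + x * z := by
  simp only [mul_def, map_add]

theorem smul_mul_aux (c : K) (x y : PathAlgebra K V) : (c • x) * y = c • (x * y) := by
  simp only [mul_def, map_smul, LinearMap.smul_apply]

theorem mul_smul_aux (c : K) (x y : PathAlgebra K V) : x * (c • y) = c • (x * y) := by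
  simp only [mul_def, map_smul]

theorem zero_mul_aux (x : PathAlgebra K V) : 0 * x = 0 := by
  simp only [mul_def, map_zero, LinearMap.zero_apply]

theorem mul_zero_aux (x : PathAlgebra K V) : x * 0 = 0 := by
  simp only [mul_def, map_zero]

theorem mul_assoc_aux (x y z : PathAlgebra K V) : x * y * z = x * (y * z) := by
  refine induction_on (P := fun x => x * y * z = x * (y * z)) x (by simp only [zero_mul_aux]) ?_ ?_
  · intro x x' h h'
    simp only [add_mul_aux, h, h']
  intro c a b p
  refine induction_on (P := fun y => (c • ofPath K p) * y * z = (c • ofPath K p) * (y * z)) y (by simp only [zero_mul_aux, mul_zero_aux]) ?_ ?_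
  · intro x x' h h'
    simp only [add_mul_aux, mul_add_aux, h, h']
  intro c' a' b' p'
  refine induction_on (P := fun z => (c • ofPath K p) * (c' • ofPath K p') * z =
    (c • ofPath K p) * ((c' • ofPath K p') * z)) z (by simp only [mul_zero_aux]) ?_ ?_
  · intro x x' h h'
    simp only [mul_add_aux, h, h']
  intro c'' a'' b'' p''
  simp only [smul_mul_aux, mul_smul_aux]
  congr 3
  by_cases h : b = a'
  · subst h
    by_cases h' : b' = a''
    · subst h'
      simp only [ofPath_mul_comp, Quiver.Path.comp_assoc]
    · simp only [ofPath_mul_comp, ofPath_mul_of_ne _ _ h', mul_zero_aux]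
  · by_cases h' : b' = a''
    · subst h'
      simp only [ofPath_mul_comp, ofPath_mul_of_ne _ _ h, zero_mul_aux]
    · simp only [ofPath_mul_of_ne _ _ h, ofPath_mul_of_ne _ _ h', zero_mul_aux, mul_zero_aux]

theorem sum_mul_aux {ι : Type*} (s : Finset ι) (f : ι → PathAlgebra K V)
    (x : PathAlgebra K V) : (∑ i ∈ s, f i) * x = ∑ i ∈ s, f i * x := by
  simp only [mul_def, map_sum, LinearMap.sum_apply]

theorem mul_sum_aux {ι : Type*} (s : Finset ι) (f : ι → PathAlgebra K V)
    (x : PathAlgebra K V) : x * (∑ i ∈ s, f i) = ∑ i ∈ s, x * f i := by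
  simp only [mul_def, map_sum]

theorem one_mul_aux [Fintype V] (x : PathAlgebra K V) : 1 * x = x := by
  refine induction_on (P := fun x => 1 * x = x) x (by simp only [mul_zero_aux]) ?_ ?_
  · intro x x' h h'
    simp only [mul_add_aux, h, h']
  intro c a b p
  rw [mul_smul_aux]
  congr 1
  change (∑ a : V, ofPath K (Quiver.Path.nil : Quiver.Path a a)) * _ = _
  rw [sum_mul_aux, Finset.sum_eq_single a]
  · rw [ofPath_mul_comp, Quiver.Path.nil_comp]
  · intro b _ hb
    exact ofPath_mul_of_ne _ _ hb
  · simp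

theorem mul_one_aux [Fintype V] (x : PathAlgebra K V) : x * 1 = x := by
  refine induction_on (P := fun x => x * 1 = x) x (by simp only [zero_mul_aux]) ?_ ?_
  · intro x x' h h'
    simp only [add_mul_aux, h, h']
  intro c a b p
  rw [smul_mul_aux]
  congr 1
  change _ * (∑ a : V, ofPath K (Quiver.Path.nil : Quiver.Path a a)) = _
  rw [mul_sum_aux, Finset.sum_eq_single b]
  · rw [ofPath_mul_comp, Quiver.Path.comp_nil]
  · intro c _ hc
    exact ofPath_mul_of_ne _ _ hc.symm
  · simp

instance [Fintype V] : Ring (PathAlgebra K V) :=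
  { (inferInstance : AddCommGroup (PathAlgebra K V)) with
    left_distrib := mul_add_aux
    right_distrib := add_mul_aux
    zero_mul := zero_mul_aux
    mul_zero := mul_zero_aux
    mul_assoc := mul_assoc_aux
    one_mul := one_mul_aux
    mul_one := mul_one_aux }

instance [Fintype V] : Algebra K (PathAlgebra K V) :=
  Algebra.ofModule smul_mul_aux mul_smul_aux

end PathAlgebra

/-! ### Admissible ideals, minimal relations -/

section Relations

variable (K : Type w) [Field K] (V : Type u) [Quiver.{v} V]

/-- The arrow ideal of `KQ`: the span of all paths of length at least one. -/
def arrowIdeal : Submodule K (PathAlgebra K V) :=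
  Submodule.span K {x | ∃ (a b : V) (p : Quiver.Path a b), 1 ≤ p.length ∧
    x = PathAlgebra.ofPath K p}

variable {K V} [Fintype V]

/-- A two-sided ideal `I` of `KQ` is admissible if `R ^ m ⊆ I ⊆ R ^ 2` for some `m ≥ 2`,
where `R` is the arrow ideal. -/
def IsAdmissible (I : Ideal (PathAlgebra K V)) : Prop :=
  I.restrictScalars K ≤ arrowIdeal K V ^ 2 ∧
    ∃ m : ℕ, 2 ≤ m ∧ arrowIdeal K V ^ m ≤ I.restrictScalars K

/-- `ρ` is a minimal relation from `a` to `b`, that is, a minimal generator of the ideal `I`: a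
linear combination of paths from `a` to `b` that lies in `I` but not in `I R + R I`. -/
def IsMinimalRelation (I : Ideal (PathAlgebra K V)) (a b : V) (ρ : PathAlgebra K V) : Prop :=
  ρ ∈ I ∧
  (∀ (c d : V) (p : Quiver.Path c d), ρ.coeff p ≠ 0 → c = a ∧ d = b) ∧
  ρ ∉ I.restrictScalars K * arrowIdeal K V + arrowIdeal K V * I.restrictScalars K

/-- `p ≺ I`: the path `p` occurs, with nonzero coefficient, in some minimal relation. -/
def OccursInMinimalRelation (I : Ideal (PathAlgebra K V)) {a b : V} (p : Quiver.Path a b) :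
    Prop :=
  ∃ ρ : PathAlgebra K V, IsMinimalRelation I a b ρ ∧ ρ.coeff p ≠ 0

end Relations

/-! ### Shape of the quiver -/

/-- The underlying graph of the quiver is connected. -/
def QuiverConnected (V : Type u) [Quiver.{v} V] : Prop :=
  Nonempty V ∧
    ∀ a b : V, Nonempty (Quiver.Path (V := Quiver.Symmetrify V) a b)

/-- At each vertex at most two arrows start and at most two arrows end. -/
def QuiverBiserial (V : Type u) [Quiver.{v} V] : Prop :=
  ∀ i : V, ENat.card (Σ j : V, (i ⟶ j)) ≤ 2 ∧ ENat.card (Σ j : V, (j ⟶ i)) ≤ 2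

/-! ### Symmetric algebras -/

/-- A finite-dimensional algebra is symmetric if it has a nondegenerate symmetric associative
bilinear form. -/
def IsSymmetricAlg (K : Type w) [Field K] (A : Type u) [Ring A] [Algebra K A] : Prop :=
  Module.Finite K A ∧ ∃ B : LinearMap.BilinForm K A,
    B.Nondegenerate ∧ (∀ x y, B x y = B y x) ∧ ∀ x y z, B (x * y) z = B x (y * z)

/-! ### Periodic algebras -/

/-- `N` is a (first) syzygy of `M`: it is isomorphic to the kernel of a projective cover
`π : P → M`, i.e. of a surjection from a projective module whose kernel is superfluous. -/
def IsSyzygy (E : Type u) [Ring E] (M N : Type u) [AddCommGroup M] [Module E M]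
    [AddCommGroup N] [Module E N] : Prop :=
  ∃ (P : Type u) (_ : AddCommGroup P) (_ : Module E P) (π : P →ₗ[E] M),
    Module.Projective E P ∧ Function.Surjective π ∧
    (∀ L : Submodule E P, L ⊔ LinearMap.ker π = ⊤ → L = ⊤) ∧
    Nonempty (N ≃ₗ[E] LinearMap.ker π)

/-- `N ≅ Ω ^ n (M)`. -/
def IsNthSyzygy (E : Type u) [Ring E] : ℕ → ∀ (M N : Type u) [AddCommGroup M] [Module E M]
    [AddCommGroup N] [Module E N], Prop
  | 0, M, N, _, _, _, _ => Nonempty (N ≃ₗ[E] M)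
  | n + 1, M, N, _, _, _, _ => ∃ (L : Type u) (_ : AddCommGroup L) (_ : Module E L),
      IsNthSyzygy E n M L ∧ IsSyzygy E L N

/-- `d` is the period of the module `M`: the least `d ≥ 1` with `Ω ^ d (M) ≅ M`. -/
def HasPeriod (E : Type u) [Ring E] (M : Type u) [AddCommGroup M] [Module E M] (d : ℕ) : Prop :=
  IsLeast {n : ℕ | 1 ≤ n ∧ IsNthSyzygy E n M M} d

/-- `A` is a periodic algebra of period `d`: it has period `d` as a bimodule over itself, i.e. as a
module over the enveloping algebra `A ⊗ Aᵒᵖ`, with `(a ⊗ b) • x = a x b`. -/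
def IsPeriodicAlg (K : Type w) [Field K] (A : Type u) [Ring A] [Algebra K A] (d : ℕ) :
    Prop :=
  letI : Module (A ⊗[K] Aᵐᵒᵖ) A := TensorProduct.Algebra.module
  HasPeriod (A ⊗[K] Aᵐᵒᵖ) A d

/-! ### Tame algebras -/

/-- A nonzero module which is not a direct sum of two nonzero submodules. -/
def IsIndecomposableMod (E : Type u) [Ring E] (M : Type v) [AddCommGroup M] [Module E M] : Prop :=
  Nontrivial M ∧ ∀ N L : Submodule E M, IsCompl N L → N = ⊥ ∨ L = ⊥

/-- The right `A`-module structure on the space of row vectors `K ^ d` given by a matrix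
representation `σ`, namely `v · a = v σ(a)`, is isomorphic to the right `A`-module `M`. -/
def RealizedBy {K : Type w} [Field K] {A : Type u} [Ring A] [Algebra K A] {d : ℕ}
    (M : Type v) [AddCommGroup M] [Module K M] [Module Aᵐᵒᵖ M]
    (σ : A →ₐ[K] Matrix (Fin d) (Fin d) K) : Prop :=
  ∃ f : M ≃ₗ[K] (Fin d → K), ∀ (a : A) (m : M),
    f (MulOpposite.op a • m) = Matrix.vecMul (f m) (σ a)

/-- The specialization at `x = c` of a matrix representation over `K[x]`. -/
def specialize {K : Type w} [Field K] {A : Type u} [Ring A] [Algebra K A] {d : ℕ}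
    (τ : A →ₐ[K] Matrix (Fin d) (Fin d) K[X]) (c : K) : A →ₐ[K] Matrix (Fin d) (Fin d) K :=
  (Polynomial.aeval c : K[X] →ₐ[K] K).mapMatrix.comp τ

/-- Tameness: in each dimension `d`, all but finitely many isomorphism classes of indecomposable
right `A`-modules of dimension `d` are of the form `K[x]/(x - c) ⊗ M` with `M` from a finite list of
`K[x]`-`A`-bimodules which are free of finite rank over `K[x]`. Such a bimodule of rank `d` is, after
the choice of a `K[x]`-basis, an algebra homomorphism `τ` from `A` to the `d × d` matrices over
`K[x]` (acting on row vectors from the right), and `K[x]/(x - c) ⊗ M` is its specialization at `c`;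
only bimodules of rank `d` contribute modules of dimension `d`. -/
def IsTame (K : Type w) [Field K] (A : Type u) [Ring A] [Algebra K A] : Prop :=
  ∀ d : ℕ, ∃ (S : Set (A →ₐ[K] Matrix (Fin d) (Fin d) K))
    (T : Set (A →ₐ[K] Matrix (Fin d) (Fin d) K[X])), S.Finite ∧ T.Finite ∧
    ∀ (M : Type u) [AddCommGroup M] [Module K M] [Module Aᵐᵒᵖ M] [IsScalarTower K Aᵐᵒᵖ M],
      Module.Finite K M → Module.finrank K M = d → IsIndecomposableMod Aᵐᵒᵖ M →
      (∃ σ ∈ S, RealizedBy M σ) ∨ ∃ τ ∈ T, ∃ c : K, RealizedBy M (specialize τ c)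

/-- TSP4 algebras: tame symmetric algebras which are periodic of period four. -/
structure IsTSP4 (K : Type w) [Field K] (A : Type u) [Ring A] [Algebra K A] : Prop where
  tame : IsTame K A
  symmetric : IsSymmetricAlg K A
  periodic : IsPeriodicAlg K A 4

end

open MulOpposite

/-! ### Symmetrizing traces and socle elements -/

section Trace

variable {K Λ : Type*} [Field K] [Ring Λ] [Algebra K Λ]

/-! Since αβγ occurs in a minimal relation, there is a minimal relation from i to j, and any minimal
relation from a to b forces an arrow b → a (`IsMinimalRelation.nonempty_hom`). Homologically,
minimal relations from a to b are seen by degree-two extensions of Λ by a one-dimensional bimodule,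
and arrows b → a by degree-one extensions with the two characters exchanged. The symmetrizing form
and period four make these dual to each other; the proof carries out the duality by hand.

If there is no arrow b → a, every derivation with the exchanged characters is inner
(`derivation_eq_inner`). Periodicity gives an exact sequence of bimodules 0 → Λ → P₃ → P₂ → P₁ → P₀
→ Λ → 0. Let χ be the character (a, b) of the enveloping algebra and s = z ⊗ z' its socle element.
Via the trace form, inner derivations split every extension of the bimodule χ by the copy of Λ at
the left end (`exists_sub_eigenvector`). Chasing through P₃ and P₂, an element of the second syzygy
killed by s lies in ker χ times that syzygy.

A functional φ on KQ vanishing on IR + RI, cut down to a and b, transports to the second syzygy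
along a comparison map and vanishes on ker χ times it. A relation ρ ∈ I ⊆ R² has a representative in
the syzygy, built by the Leibniz rule and killed by s, on which the transported functional is -φ(ρ).
Hence φ(ρ) = 0 (`functional_eq_zero`), whereas minimality of ρ provides a φ with φ(ρ) ≠ 0. -/

/-- A linear form with `T (x * y) = T (y * x)` such that `x ↦ T (x * ·)` is a bijection from the
algebra to its dual space. -/
structure IsSymmetrizingTrace (T : Λ →ₗ[K] K) : Prop where
  comm : ∀ x y, T (x * y) = T (y * x)
  nondegenerate : ∀ x, (∀ y, T (x * y) = 0) → x = 0
  exists_repr : ∀ L : Λ →ₗ[K] K, ∃ x, ∀ y, T (x * y) = L y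

/-- The trace is x ↦ B(x, 1); associativity of B recovers B(x, y) as the trace of xy. -/
theorem IsSymmetricAlg.exists_isSymmetrizingTrace (h : IsSymmetricAlg K Λ) :
    ∃ T : Λ →ₗ[K] K, IsSymmetrizingTrace T := by
  obtain ⟨hfin, B, hB, hsymm, hassoc⟩ := h
  have key : ∀ x y, B.flip 1 (x * y) = B x y := fun x y => by
    change B (x * y) 1 = _
    rw [hassoc, mul_one]
  refine ⟨B.flip 1, fun x y => ?_, fun x hx => ?_, fun L => ⟨(B.toDual hB).symm L, fun y => ?_⟩⟩
  · rw [key, key, hsymm]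
  · apply (B.toDual hB).injective
    ext y
    rw [LinearMap.BilinForm.toDual_def, ← key, hx, map_zero, LinearMap.zero_apply]
  · rw [key, LinearMap.BilinForm.apply_toDual_symm_apply]

/-- `z` represents the character `ε` with respect to the trace `T`. -/
def RepresentsChar (T : Λ →ₗ[K] K) (ε : Λ →ₐ[K] K) (z : Λ) : Prop :=
  ∀ y, T (z * y) = ε y

variable {T : Λ →ₗ[K] K} {ε : Λ →ₐ[K] K} {z : Λ}

namespace IsSymmetrizingTrace

theorem ext (hT : IsSymmetrizingTrace T) {x x' : Λ} (h : ∀ y, T (x * y) = T (x' * y)) :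
    x = x' := by
  rw [← sub_eq_zero]
  refine hT.nondegenerate _ fun y => ?_
  rw [sub_mul, map_sub, h, sub_self]

theorem mul_left_eq_smul (hT : IsSymmetrizingTrace T) (hz : RepresentsChar T ε z) (a : Λ) :
    a * z = ε a • z := by
  refine hT.ext fun y => ?_
  rw [mul_assoc, hT.comm, mul_assoc, hz, smul_mul_assoc, map_smul, hz, map_mul, smul_eq_mul,
    mul_comm]

theorem mul_right_eq_smul (hT : IsSymmetrizingTrace T) (hz : RepresentsChar T ε z) (a : Λ) :
    z * a = ε a • z := by
  refine hT.ext fun y => ?_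
  rw [mul_assoc, hz, smul_mul_assoc, map_smul, hz, map_mul, smul_eq_mul]

/-- The ε-eigenspace of left multiplication is the line through `z`: pairing an eigenvector with a
gives ε(a) times its trace. -/
theorem eq_smul_of_mul_left (hT : IsSymmetrizingTrace T) (hz : RepresentsChar T ε z) {y : Λ}
    (hy : ∀ a, a * y = ε a • y) : y = T y • z := by
  refine hT.ext fun a => ?_
  rw [hT.comm, hy, smul_mul_assoc, map_smul, map_smul, hz, smul_eq_mul, smul_eq_mul, mul_comm]

end IsSymmetrizingTrace

theorem RepresentsChar.trace_eq_one (hz : RepresentsChar T ε z) : T z = 1 := by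
  have := hz 1
  rwa [mul_one, map_one] at this

end Trace

/-! ### The enveloping algebra -/

section Enveloping

variable {K Λ : Type*} [Field K] [Ring Λ] [Algebra K Λ]

/-- The character `a ⊗ b ↦ ε a * ε' b` of the enveloping algebra. -/
noncomputable def envChar (ε ε' : Λ →ₐ[K] K) : Λ ⊗[K] Λᵐᵒᵖ →ₐ[K] K :=
  Algebra.TensorProduct.lift ε (ε'.fromOpposite fun _ _ => Commute.all _ _)
    fun _ _ => Commute.all _ _

@[simp]
theorem envChar_tmul (ε ε' : Λ →ₐ[K] K) (a : Λ) (b : Λᵐᵒᵖ) :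
    envChar ε ε' (a ⊗ₜ b) = ε a * ε' b.unop := by
  simp [envChar]

/-- The algebra homomorphism `a ⊗ b ↦ ε a • b` from the enveloping algebra to `Λᵐᵒᵖ`. -/
noncomputable def envRight (ε : Λ →ₐ[K] K) : Λ ⊗[K] Λᵐᵒᵖ →ₐ[K] Λᵐᵒᵖ :=
  Algebra.TensorProduct.lift ((Algebra.ofId K Λᵐᵒᵖ).comp ε) (AlgHom.id K Λᵐᵒᵖ)
    fun a b => by
      change Commute (algebraMap K Λᵐᵒᵖ (ε a)) b
      exact Algebra.commutes (ε a) b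

@[simp]
theorem envRight_tmul (ε : Λ →ₐ[K] K) (a : Λ) (b : Λᵐᵒᵖ) :
    envRight ε (a ⊗ₜ b) = ε a • b := by
  rw [envRight, Algebra.TensorProduct.lift_tmul, Algebra.smul_def]
  rfl

theorem char_unop_envRight (ε ε' : Λ →ₐ[K] K) (e : Λ ⊗[K] Λᵐᵒᵖ) :
    ε' (envRight ε e).unop = envChar ε ε' e := by
  induction e with
  | zero => simp
  | tmul a b => simp
  | add x y hx hy => simp [hx, hy]

variable {T : Λ →ₗ[K] K} {ε ε' : Λ →ₐ[K] K} {z z' : Λ}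

/-- With `env_mul_right`, `env_eq_smul` and `env_ne_zero`, this makes z ⊗ z' a two-sided eigenvector
of the enveloping algebra that spans the left eigenspace of its character. -/
theorem IsSymmetrizingTrace.env_mul_left (hT : IsSymmetrizingTrace T)
    (hz : RepresentsChar T ε z) (hz' : RepresentsChar T ε' z') (e : Λ ⊗[K] Λᵐᵒᵖ) :
    e * (z ⊗ₜ op z') = envChar ε ε' e • (z ⊗ₜ[K] op z') := by
  induction e with
  | zero => simp
  | tmul a b =>
    obtain ⟨b, rfl⟩ := op_surjective b
    rw [Algebra.TensorProduct.tmul_mul_tmul, ← op_mul, hT.mul_left_eq_smul hz,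
      hT.mul_right_eq_smul hz', envChar_tmul, op_smul, TensorProduct.smul_tmul_smul, unop_op]
  | add x y hx hy => simp only [add_mul, hx, hy, map_add, add_smul]

theorem IsSymmetrizingTrace.env_mul_right (hT : IsSymmetrizingTrace T)
    (hz : RepresentsChar T ε z) (hz' : RepresentsChar T ε' z') (e : Λ ⊗[K] Λᵐᵒᵖ) :
    (z ⊗ₜ op z') * e = envChar ε ε' e • (z ⊗ₜ[K] op z') := by
  induction e with
  | zero => simp
  | tmul a b =>
    obtain ⟨b, rfl⟩ := op_surjective b
    rw [Algebra.TensorProduct.tmul_mul_tmul, ← op_mul, hT.mul_right_eq_smul hz,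
      hT.mul_left_eq_smul hz', envChar_tmul, op_smul, TensorProduct.smul_tmul_smul, unop_op]
  | add x y hx hy => simp only [mul_add, hx, hy, map_add, add_smul]

/-- The map `T ⊗ id : Λ ⊗ Λᵐᵒᵖ → Λᵐᵒᵖ`. -/
noncomputable def traceLeft (T : Λ →ₗ[K] K) : Λ ⊗[K] Λᵐᵒᵖ →ₗ[K] Λᵐᵒᵖ :=
  (TensorProduct.lid K Λᵐᵒᵖ).toLinearMap ∘ₗ T.rTensor Λᵐᵒᵖ

theorem traceLeft_tmul (a : Λ) (b : Λᵐᵒᵖ) : traceLeft T (a ⊗ₜ b) = T a • b := by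
  simp [traceLeft]

theorem traceLeft_mul (b : Λᵐᵒᵖ) (y : Λ ⊗[K] Λᵐᵒᵖ) :
    traceLeft T ((1 ⊗ₜ b) * y) = b * traceLeft T y := by
  induction y with
  | zero => simp
  | tmul a c => simp [traceLeft_tmul]
  | add x y hx hy => simp only [mul_add, map_add, hx, hy]

/-- In coordinates over a basis of the right factor, each coordinate is a left ε-eigenvector of Λ,
hence its own trace times `z`. -/
theorem IsSymmetrizingTrace.env_eq_tmul (hT : IsSymmetrizingTrace T)
    (hz : RepresentsChar T ε z) {y : Λ ⊗[K] Λᵐᵒᵖ}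
    (hy : ∀ a : Λ, (a ⊗ₜ[K] (1 : Λᵐᵒᵖ)) * y = ε a • y) : y = z ⊗ₜ traceLeft T y := by
  classical
  let b := Module.Basis.ofVectorSpace K Λᵐᵒᵖ
  let Φ := TensorProduct.equivFinsuppOfBasisRight (M := Λ) b
  have hmul : ∀ (a : Λ) (y : Λ ⊗[K] Λᵐᵒᵖ) m, Φ ((a ⊗ₜ 1) * y) m = a * Φ y m := by
    intro a y m
    induction y with
    | zero => simp
    | tmul c d =>
      simp [Φ]
    | add x y hx hy => simp only [mul_add, map_add, Finsupp.add_apply, hx, hy]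
  have htr : ∀ (y : Λ ⊗[K] Λᵐᵒᵖ) m, b.repr (traceLeft T y) m = T (Φ y m) := by
    intro y m
    induction y with
    | zero => simp
    | tmul c d =>
      simp [Φ, traceLeft_tmul, mul_comm]
    | add x y hx hy => simp only [map_add, Finsupp.add_apply, hx, hy]
  apply Φ.injective
  ext m
  rw [TensorProduct.equivFinsuppOfBasisRight_apply_tmul_apply, htr]
  refine hT.eq_smul_of_mul_left hz fun a => ?_
  rw [← hmul, hy, map_smul, Finsupp.smul_apply]

theorem IsSymmetrizingTrace.env_eq_smul (hT : IsSymmetrizingTrace T)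
    (hz : RepresentsChar T ε z) (hz' : RepresentsChar T ε' z') {y : Λ ⊗[K] Λᵐᵒᵖ}
    (hy : ∀ e, e * y = envChar ε ε' e • y) : ∃ c : K, y = c • (z ⊗ₜ[K] op z') := by
  have h1 := hT.env_eq_tmul hz (y := y) fun a => by simp [hy]
  have h2 : ∀ b : Λ, op b * traceLeft T y = ε' b • traceLeft T y := fun b => by
    rw [← traceLeft_mul, hy, map_smul]; simp
  obtain ⟨d, hd⟩ := op_surjective (traceLeft T y)
  rw [← hd] at h1 h2
  refine ⟨T d, ?_⟩
  have h3 : d = T d • z' := by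
    refine hT.ext fun a => ?_
    have := congrArg unop (h2 a)
    rw [unop_mul, unop_op, unop_op, unop_smul, unop_op] at this
    rw [this, map_smul, smul_mul_assoc, map_smul, hz', smul_eq_mul, smul_eq_mul, mul_comm]
  conv_lhs => rw [h1, h3]
  rw [op_smul, TensorProduct.tmul_smul]

theorem RepresentsChar.env_ne_zero (hz : RepresentsChar T ε z) (hz' : RepresentsChar T ε' z') :
    z ⊗ₜ[K] op z' ≠ 0 := by
  intro h
  have h1 := congrArg (traceLeft T) h
  rw [traceLeft_tmul, hz.trace_eq_one, one_smul, map_zero, op_eq_zero_iff] at h1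
  have h2 := hz'.trace_eq_one
  rw [h1, map_zero] at h2
  exact zero_ne_one h2

end Enveloping

/-! ### Projective modules and socle elements -/

section Projective

variable {K E P : Type*} [Field K] [Ring E] [Algebra K E] [AddCommGroup P] [Module E P]
  [Module.Projective E P] {χ : E →ₐ[K] K} {s : E}

/-- Embed P as a summand of a free module: s acts on each coordinate e as χ(e)s, so being killed by
s forces every coordinate into ker χ. -/
theorem exists_sum_of_smul_eq_zero (hs : ∀ e, s * e = χ e • s) (hs0 : s ≠ 0) {q : P}
    (hq : s • q = 0) :
    ∃ f : P →₀ E, (∀ x, χ (f x) = 0) ∧ q = f.sum fun x e => e • x := by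
  obtain ⟨σ, hσ⟩ := Module.projective_def'.1 ‹Module.Projective E P›
  refine ⟨σ q, fun x => ?_, ?_⟩
  · have : s * σ q x = 0 := by
      rw [← smul_eq_mul, ← Finsupp.smul_apply, ← map_smul, hq, map_zero, Finsupp.zero_apply]
    rw [hs] at this
    exact (smul_eq_zero.1 this).resolve_right hs0
  · have := LinearMap.congr_fun hσ q
    exact this.symm

/-- In a free module the coordinates of a χ-eigenvector are multiples of s, and s factors out; a
projective module inherits this as a summand. -/
theorem exists_eq_smul_of_forall_smul_eq
    (hs : ∀ y : E, (∀ e, e * y = χ e • y) → ∃ c : K, y = c • s) {q : P}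
    (hq : ∀ e : E, e • q = algebraMap K E (χ e) • q) : ∃ w : P, q = s • w := by
  obtain ⟨σ, hσ⟩ := Module.projective_def'.1 ‹Module.Projective E P›
  have h : ∀ x, ∃ c : K, σ q x = c • s := fun x => hs _ fun e => by
    rw [← smul_eq_mul, ← Finsupp.smul_apply, ← map_smul, hq, map_smul, Finsupp.smul_apply,
      smul_eq_mul, Algebra.smul_def]
  choose c hc using h
  refine ⟨∑ x ∈ (σ q).support, algebraMap K E (c x) • x, ?_⟩
  have := LinearMap.congr_fun hσ q
  rw [LinearMap.id_apply, LinearMap.comp_apply, Finsupp.linearCombination_apply,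
    Finsupp.sum] at this
  rw [Finset.smul_sum]
  refine this.symm.trans (Finset.sum_congr rfl fun x _ => ?_)
  rw [hc, smul_smul, Algebra.smul_def, Algebra.commutes, id]

end Projective

/-! ### Extensions of a one-dimensional bimodule by the algebra -/

section Extension

variable {K Λ : Type*} [Field K] [Ring Λ] [Algebra K Λ] {T : Λ →ₗ[K] K} {ε ε' : Λ →ₐ[K] K}

/-- Every `(ε', ε)`-derivation with values in `K` is inner. -/
def DerivationsInner (ε' ε : Λ →ₐ[K] K) : Prop :=
  ∀ g : Λ →ₗ[K] K, (∀ a b, g (a * b) = ε' a * g b + ε b * g a) → ∃ c, ∀ a, g a = c * (ε' a - ε a)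

/-- An additive map from `Λ` to a module over the enveloping algebra which respects the bimodule
structures. -/
structure IsBimodMapFrom {M : Type*} [AddCommGroup M] [Module (Λ ⊗[K] Λᵐᵒᵖ) M]
    (f : Λ →+ M) : Prop where
  map_mul_left : ∀ a x, f (a * x) = (a ⊗ₜ[K] (1 : Λᵐᵒᵖ)) • f x
  map_mul_right : ∀ x b, f (x * b) = ((1 : Λ) ⊗ₜ[K] op b) • f x

/-- If all `(ε', ε)`-derivations are inner, then an extension of the one-dimensional bimodule with
characters `ε`, `ε'` by a symmetric algebra splits. -/
theorem IsSymmetrizingTrace.exists_sub_eigenvector (hT : IsSymmetrizingTrace T)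
    (hder : DerivationsInner ε' ε) {M : Type*} [AddCommGroup M] [Module (Λ ⊗[K] Λᵐᵒᵖ) M]
    [Module K M] [IsScalarTower K (Λ ⊗[K] Λᵐᵒᵖ) M] {f : Λ →+ M} (hf : IsBimodMapFrom (K := K) f)
    (hinj : Function.Injective f) {v : M}
    (hv : ∀ e : Λ ⊗[K] Λᵐᵒᵖ, ∃ x, f x = e • v - envChar ε ε' e • v) :
    ∃ l : Λ, ∀ e : Λ ⊗[K] Λᵐᵒᵖ, e • (v - f l) = envChar ε ε' e • (v - f l) := by
  have hsmul : ∀ (c : K) x, f (c • x) = c • f x := fun c x => by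
    rw [Algebra.smul_def, hf.map_mul_left, ← Algebra.TensorProduct.algebraMap_apply,
      algebraMap_smul]
  have hleft : ∀ a : Λ, ∃ x, f x = (a ⊗ₜ[K] (1 : Λᵐᵒᵖ)) • v - ε a • v := fun a => by
    simpa using hv (a ⊗ₜ 1)
  have hright : ∀ b : Λ, ∃ x, f x = ((1 : Λ) ⊗ₜ[K] op b) • v - ε' b • v := fun b => by
    simpa using hv (1 ⊗ₜ op b)
  -- `D` and `D'` measure how far `v` is from being an eigenvector on the left and on the right.
  -- Injectivity of `f` moves the module identities into Λ, where both maps satisfy twisted Leibniz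
  -- rules.
  choose D hD using hleft
  choose D' hD' using hright
  have hDadd : ∀ a b, D (a + b) = D a + D b := fun a b => hinj <| by
    rw [map_add, hD, hD, hD, TensorProduct.add_tmul, map_add, add_smul]
    generalize (a ⊗ₜ[K] (1 : Λᵐᵒᵖ)) • v = m, (b ⊗ₜ[K] (1 : Λᵐᵒᵖ)) • v = m'
    module
  have hDsmul : ∀ (c : K) a, D (c • a) = c • D a := fun c a => hinj <| by
    rw [hsmul, hD, hD, ← TensorProduct.smul_tmul', smul_assoc, map_smul, smul_eq_mul]
    generalize (a ⊗ₜ[K] (1 : Λᵐᵒᵖ)) • v = m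
    module
  have hDadd' : ∀ a b, D' (a + b) = D' a + D' b := fun a b => hinj <| by
    rw [map_add, hD', hD', hD', op_add, TensorProduct.tmul_add, map_add, add_smul]
    generalize ((1 : Λ) ⊗ₜ[K] op a) • v = m, ((1 : Λ) ⊗ₜ[K] op b) • v = m'
    module
  have hDsmul' : ∀ (c : K) a, D' (c • a) = c • D' a := fun c a => hinj <| by
    rw [hsmul, hD', hD', op_smul, TensorProduct.tmul_smul, smul_assoc, map_smul, smul_eq_mul]
    generalize ((1 : Λ) ⊗ₜ[K] op a) • v = m
    module
  have hDmul : ∀ a b, D (a * b) = a * D b + ε b • D a := fun a b => hinj <| by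
    have : (a * b) ⊗ₜ[K] (1 : Λᵐᵒᵖ) = (a ⊗ₜ 1) * (b ⊗ₜ 1) := by simp
    rw [map_add, hf.map_mul_left, hsmul, hD, hD, hD, this, mul_smul, map_mul, smul_sub,
      smul_comm (a ⊗ₜ[K] (1 : Λᵐᵒᵖ)) (ε b) v]
    generalize (a ⊗ₜ[K] (1 : Λᵐᵒᵖ)) • (b ⊗ₜ[K] (1 : Λᵐᵒᵖ)) • v = m, (a ⊗ₜ[K] (1 : Λᵐᵒᵖ)) • v = m'
    module
  have hDmul' : ∀ a b, D' (a * b) = D' a * b + ε' a • D' b := fun a b => hinj <| by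
    have : (1 : Λ) ⊗ₜ[K] op (a * b) = (1 ⊗ₜ op b) * (1 ⊗ₜ op a) := by simp
    rw [map_add, hf.map_mul_right, hsmul, hD', hD', hD', this, mul_smul, map_mul, smul_sub,
      smul_comm ((1 : Λ) ⊗ₜ[K] op b) (ε' a) v]
    generalize ((1 : Λ) ⊗ₜ[K] op b) • ((1 : Λ) ⊗ₜ[K] op a) • v = m,
      ((1 : Λ) ⊗ₜ[K] op b) • v = m'
    module
  -- This compatibility expresses that the left and right actions on `v` commute.
  have hcomm : ∀ a b, a * D' b - ε a • D' b = D a * b - ε' b • D a := fun a b => hinj <| by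
    rw [map_sub, map_sub, hf.map_mul_left, hf.map_mul_right, hsmul, hsmul, hD, hD', 
      smul_sub (a ⊗ₜ[K] (1 : Λᵐᵒᵖ)), smul_sub ((1 : Λ) ⊗ₜ[K] op b),
      smul_comm (a ⊗ₜ[K] (1 : Λᵐᵒᵖ)) (ε' b) v, smul_comm ((1 : Λ) ⊗ₜ[K] op b) (ε a) v,
      ← mul_smul, ← mul_smul, Algebra.TensorProduct.tmul_mul_tmul,
      Algebra.TensorProduct.tmul_mul_tmul, one_mul, mul_one, one_mul, mul_one]
    generalize (a ⊗ₜ[K] op b) • v = m, (a ⊗ₜ[K] (1 : Λᵐᵒᵖ)) • v = m₁,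
      ((1 : Λ) ⊗ₜ[K] op b) • v = m₂
    module
  have hcommT : ∀ a b, T (a * D' b) - ε a * T (D' b) = T (D a * b) - ε' b * T (D a) := by
    intro a b
    simpa using congrArg T (hcomm a b)
  let Dl : Λ →ₗ[K] Λ := IsLinearMap.mk' D ⟨hDadd, hDsmul⟩
  let Dl' : Λ →ₗ[K] Λ := IsLinearMap.mk' D' ⟨hDadd', hDsmul'⟩
  -- Cyclicity of the trace exchanges left and right, so the scalar derivation has its characters in
  -- the order (ε', ε).
  obtain ⟨c, hc⟩ := hder (T ∘ₗ Dl - T ∘ₗ Dl') <| by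
    intro a b
    change T (D (a * b)) - T (D' (a * b)) =
      ε' a * (T (D b) - T (D' b)) + ε b * (T (D a) - T (D' a))
    have h := hcommT b a
    rw [hDmul, hDmul', map_add, map_add, map_smul, map_smul, hT.comm a, hT.comm _ b, smul_eq_mul,
      smul_eq_mul]
    linear_combination -h
  replace hc : ∀ a, T (D a) - T (D' a) = c * (ε' a - ε a) := hc
  -- The correction `l` is the element representing cε + T∘D; the constant c makes the same `l`
  -- correct the right action too.
  obtain ⟨l, hl⟩ := hT.exists_repr (c • ε.toLinearMap + T ∘ₗ Dl)
  replace hl : ∀ y, T (l * y) = c * ε y + T (D y) := hl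
  have hlD : ∀ a, a * l = ε a • l + D a := fun a => hT.ext fun y => by
    rw [mul_assoc, hT.comm, mul_assoc, hl, add_mul, map_add, smul_mul_assoc, map_smul, hl, hDmul,
      map_add, map_smul, map_mul, hT.comm y, smul_eq_mul, smul_eq_mul]
    ring
  have hlD' : ∀ b, l * b = ε' b • l + D' b := fun b => hT.ext fun y => by
    have h1 := hcommT y b
    have h2 := hc b
    rw [mul_assoc, hl, add_mul, map_add, smul_mul_assoc, map_smul, hl, hDmul, map_add, map_smul,
      map_mul, hT.comm b, hT.comm _ y, smul_eq_mul, smul_eq_mul]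
    linear_combination ε y * h2 - h1
  refine ⟨l, fun e => ?_⟩
  have hel : ∀ a : Λ, (a ⊗ₜ[K] (1 : Λᵐᵒᵖ)) • (v - f l) = ε a • (v - f l) := fun a => by
    rw [smul_sub, ← hf.map_mul_left, hlD, map_add, hsmul, hD]
    generalize (a ⊗ₜ[K] (1 : Λᵐᵒᵖ)) • v = m
    module
  have her : ∀ b : Λ, ((1 : Λ) ⊗ₜ[K] op b) • (v - f l) = ε' b • (v - f l) := fun b => by
    rw [smul_sub, ← hf.map_mul_right, hlD', map_add, hsmul, hD']
    generalize ((1 : Λ) ⊗ₜ[K] op b) • v = m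
    module
  induction e with
  | zero => rw [map_zero, zero_smul K]; exact zero_smul (Λ ⊗[K] Λᵐᵒᵖ) (v - f l)
  | tmul a b =>
    obtain ⟨b, rfl⟩ := op_surjective b
    have : a ⊗ₜ[K] op b = (a ⊗ₜ 1) * (1 ⊗ₜ op b) := by simp
    rw [this, mul_smul, her, smul_comm, hel, map_mul, smul_smul]
    congr 1
    simp [mul_comm]
  | add x y hx hy => rw [add_smul, hx, hy, map_add, add_smul]

end Extension

/-! ### Four-term bimodule resolutions -/

section Resolution

variable {K Λ : Type*} [Field K] [Ring Λ] [Algebra K Λ] {T : Λ →ₗ[K] K} {ε ε' : Λ →ₐ[K] K}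
  {z z' : Λ}

/-- An exact sequence `0 → Λ → P₃ → P₂ → P₁ → P₀ → Λ → 0` of bimodules. -/
structure IsFourTermResolution {P₃ P₂ P₁ P₀ : Type*} [AddCommGroup P₃] [AddCommGroup P₂]
    [AddCommGroup P₁] [AddCommGroup P₀] [Module (Λ ⊗[K] Λᵐᵒᵖ) P₃] [Module (Λ ⊗[K] Λᵐᵒᵖ) P₂]
    [Module (Λ ⊗[K] Λᵐᵒᵖ) P₁] [Module (Λ ⊗[K] Λᵐᵒᵖ) P₀] (f : Λ →+ P₃)
    (d₃ : P₃ →ₗ[Λ ⊗[K] Λᵐᵒᵖ] P₂) (d₂ : P₂ →ₗ[Λ ⊗[K] Λᵐᵒᵖ] P₁) (d₁ : P₁ →ₗ[Λ ⊗[K] Λᵐᵒᵖ] P₀)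
    (p : P₀ →+ Λ) : Prop where
  bimodMap : IsBimodMapFrom (K := K) f
  injective : Function.Injective f
  exact₃ : Function.Exact f d₃
  exact₂ : Function.Exact d₃ d₂
  exact₁ : Function.Exact d₂ d₁
  exact₀ : Function.Exact d₁ p
  surjective : Function.Surjective p
  aug_smul : ∀ a b x, p ((a ⊗ₜ[K] op b) • x) = a * p x * b

variable {P₃ P₂ P₁ P₀ : Type*} [AddCommGroup P₃] [AddCommGroup P₂]
    [AddCommGroup P₁] [AddCommGroup P₀] [Module (Λ ⊗[K] Λᵐᵒᵖ) P₃] [Module (Λ ⊗[K] Λᵐᵒᵖ) P₂]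
    [Module (Λ ⊗[K] Λᵐᵒᵖ) P₁] [Module (Λ ⊗[K] Λᵐᵒᵖ) P₀] {f : Λ →+ P₃}
    {d₃ : P₃ →ₗ[Λ ⊗[K] Λᵐᵒᵖ] P₂} {d₂ : P₂ →ₗ[Λ ⊗[K] Λᵐᵒᵖ] P₁} {d₁ : P₁ →ₗ[Λ ⊗[K] Λᵐᵒᵖ] P₀}
    {p : P₀ →+ Λ}

namespace IsFourTermResolution

/-- If all `(ε', ε)`-derivations are inner, then a second syzygy killed by the socle element
`z ⊗ z'` lies in the product of the kernel of the character `(ε, ε')` with the second syzygy. -/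
theorem exists_sum_of_smul_eq_zero (h : IsFourTermResolution f d₃ d₂ d₁ p)
    [Module.Projective (Λ ⊗[K] Λᵐᵒᵖ) P₃] [Module.Projective (Λ ⊗[K] Λᵐᵒᵖ) P₂]
    (hT : IsSymmetrizingTrace T) (hz : RepresentsChar T ε z) (hz' : RepresentsChar T ε' z')
    (hder : DerivationsInner ε' ε) {x : P₁} (hx : d₁ x = 0) (hsx : (z ⊗ₜ[K] op z') • x = 0) :
    ∃ n : P₂ →₀ Λ ⊗[K] Λᵐᵒᵖ, (∀ y, envChar ε ε' (n y) = 0) ∧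
      x = n.sum fun y e => e • d₂ y := by
  let _ : Module K P₃ := Module.compHom P₃ (algebraMap K (Λ ⊗[K] Λᵐᵒᵖ))
  have : IsScalarTower K (Λ ⊗[K] Λᵐᵒᵖ) P₃ := ⟨fun c e x => by
    have : c • e = algebraMap K (Λ ⊗[K] Λᵐᵒᵖ) c * e := Algebra.smul_def c e
    rw [this, mul_smul]
    rfl⟩
  obtain ⟨y, rfl⟩ := (h.exact₁ x).1 hx
  obtain ⟨v, hv⟩ := (h.exact₂ ((z ⊗ₜ[K] op z') • y)).1 (by rw [map_smul, hsx])
  -- Since d₃ v = s • y is a χ-eigenvector, `v` is one modulo the image of Λ; splitting the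
  -- extension corrects it to a true one.
  obtain ⟨l, hl⟩ := hT.exists_sub_eigenvector hder h.bimodMap h.injective (v := v) fun e => by
    refine (h.exact₃ _).1 ?_
    rw [← algebraMap_smul (Λ ⊗[K] Λᵐᵒᵖ), map_sub, map_smul, map_smul, hv, smul_smul, smul_smul,
      hT.env_mul_left hz hz', sub_eq_zero]
    exact congrArg (· • y) (Algebra.smul_def (envChar ε ε' e) (z ⊗ₜ[K] op z'))
  obtain ⟨w, hw⟩ := exists_eq_smul_of_forall_smul_eq
    (fun y hy => hT.env_eq_smul hz hz' hy) (q := v - f l) hl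
  have hfl : d₃ (f l) = 0 := (h.exact₃ _).2 ⟨l, rfl⟩
  -- Replacing y by y - d₃ w does not change its image under d₂, but makes it killed by s.
  have hyw : (z ⊗ₜ[K] op z') • (y - d₃ w) = 0 := by
    rw [smul_sub, ← map_smul, ← hw, map_sub, hfl, sub_zero, hv, sub_self]
  obtain ⟨n, hn, hyn⟩ := _root_.exists_sum_of_smul_eq_zero
    (fun e => hT.env_mul_right hz hz' e) (hz.env_ne_zero hz') hyw
  refine ⟨n, hn, ?_⟩
  have hdw : d₂ (d₃ w) = 0 := (h.exact₂ _).2 ⟨w, rfl⟩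
  have := congrArg d₂ hyn
  rw [map_sub, hdw, sub_zero] at this
  rw [this, Finsupp.sum, Finsupp.sum, map_sum]
  simp only [map_smul]

theorem char_map_smul (h : IsFourTermResolution f d₃ d₂ d₁ p) (ε : Λ →ₐ[K] K)
    (e : Λ ⊗[K] Λᵐᵒᵖ) (x : P₀) : ε (p (e • x)) = envChar ε ε e * ε (p x) := by
  induction e with
  | zero =>
    have : (0 : Λ ⊗[K] Λᵐᵒᵖ) • x = 0 := zero_smul (Λ ⊗[K] Λᵐᵒᵖ) x
    rw [this, map_zero, map_zero, map_zero, zero_mul]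
  | tmul a b =>
    obtain ⟨b, rfl⟩ := op_surjective b
    rw [h.aug_smul, map_mul, map_mul, envChar_tmul, unop_op]
    ring
  | add x y hx hy => rw [add_smul, map_add, map_add, hx, hy, map_add, add_mul]

/-- The augmentation followed by the character `ε` lifts to a map to `Λ` that is linear with respect
to the left action through `ε`. -/
theorem exists_lift_zero (h : IsFourTermResolution f d₃ d₂ d₁ p)
    [Module.Projective (Λ ⊗[K] Λᵐᵒᵖ) P₀] (ε : Λ →ₐ[K] K) :
    ∃ G : P₀ →+ Λ, (∀ e x, G (e • x) = G x * (envRight ε e).unop) ∧ ∀ x, ε (G x) = ε (p x) := by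
  obtain ⟨σ, hσ⟩ := Module.projective_def'.1 ‹Module.Projective (Λ ⊗[K] Λᵐᵒᵖ) P₀›
  have hσ' : ∀ x, (σ x).sum (fun y e => e • y) = x := fun x => LinearMap.congr_fun hσ x
  -- Define the map on the free cover of P₀ by collapsing the left action through ε, then restrict
  -- along the section `σ`.
  let G : P₀ →+ Λ := (Finsupp.liftAddHom fun y : P₀ => AddMonoidHom.mk'
    (fun e : Λ ⊗[K] Λᵐᵒᵖ => ε (p y) • (envRight ε e).unop) fun e e' => by
      rw [map_add, unop_add, smul_add]).comp σ.toAddMonoidHom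
  have hG : ∀ x, G x = (σ x).sum fun y e => ε (p y) • (envRight ε e).unop := fun x => rfl
  refine ⟨G, fun e x => ?_, fun x => ?_⟩
  · rw [hG, hG, map_smul, Finsupp.sum_smul_index, Finsupp.sum, Finsupp.sum, Finset.sum_mul]
    · refine Finset.sum_congr rfl fun y _ => ?_
      rw [map_mul, unop_mul, smul_mul_assoc]
    · simp
  · conv_rhs => rw [← hσ' x]
    rw [hG, Finsupp.sum, Finsupp.sum, map_sum, map_sum, map_sum]
    refine Finset.sum_congr rfl fun y _ => ?_
    rw [map_smul, char_unop_envRight, h.char_map_smul, smul_eq_mul, mul_comm]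

variable {A : Type*} [Ring A] [Algebra K A]

/-- The comparison map in degree one, lifting G ∘ d₁ through π. It is right linear only after
applying φ. -/
theorem exists_lift_one (h : IsFourTermResolution f d₃ d₂ d₁ p)
    [Module.Projective (Λ ⊗[K] Λᵐᵒᵖ) P₁] {π : A →ₐ[K] Λ} (hπ : Function.Surjective π)
    {G : P₀ →+ Λ} (hG : ∀ e x, G (e • x) = G x * (envRight ε e).unop)
    (hGp : ∀ x, ε (G x) = ε (p x)) {φ : A →ₗ[K] K}
    (hφ : ∀ x r, π r = 0 → φ (x * r) = ε (π x) * φ r) :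
    ∃ H : P₁ →+ A, (∀ x, π (H x) = G (d₁ x)) ∧
      ∀ e x a, π a = (envRight ε e).unop → φ (H (e • x)) = φ (H x * a) := by
  obtain ⟨σ, hσ⟩ := Module.projective_def'.1 ‹Module.Projective (Λ ⊗[K] Λᵐᵒᵖ) P₁›
  have hσ' : ∀ x, (σ x).sum (fun y e => e • y) = x := fun x => LinearMap.congr_fun hσ x
  obtain ⟨τ, hτ⟩ := π.toLinearMap.exists_rightInverse_of_surjective (LinearMap.range_eq_top.2 hπ)
  replace hτ : ∀ x, π (τ x) = x := fun x => LinearMap.congr_fun hτ x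
  choose w hw using fun x => hπ (G (d₁ x))
  let H : P₁ →+ A := (Finsupp.liftAddHom fun y : P₁ => AddMonoidHom.mk'
    (fun e : Λ ⊗[K] Λᵐᵒᵖ => w y * τ (envRight ε e).unop) fun e e' => by
      rw [map_add, unop_add, map_add, mul_add]).comp σ.toAddMonoidHom
  have hH : ∀ x, H x = (σ x).sum fun y e => w y * τ (envRight ε e).unop := fun x => rfl
  refine ⟨H, fun x => ?_, fun e x a ha => ?_⟩
  · conv_rhs => rw [← hσ' x]
    rw [hH, Finsupp.sum, Finsupp.sum, map_sum, map_sum, map_sum]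
    refine Finset.sum_congr rfl fun y _ => ?_
    rw [map_mul, hw, hτ, map_smul, hG]
  · rw [hH, hH, map_smul, Finsupp.sum_smul_index, Finsupp.sum, Finsupp.sum, Finset.sum_mul,
      map_sum, map_sum]
    · refine Finset.sum_congr rfl fun y _ => ?_
      -- The linearity error is `w y` times an element of ker π. There φ gives the factor ε(G(d₁ y))
      -- = ε(p(d₁ y)) = 0.
      rw [← sub_eq_zero, ← map_sub, mul_assoc, ← mul_sub, hφ, hw, hGp,
        (h.exact₀ _).2 ⟨y, rfl⟩, map_zero, zero_mul]
      rw [map_sub, map_mul π, hτ, hτ, ha, map_mul, unop_mul, sub_self]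
    · simp

/-- If all `(ε', ε)`-derivations of a symmetric algebra `Λ = A / ker π` with a four-term bimodule
resolution are inner, then every `(ε, ε')`-equivariant functional on the relations vanishes. -/
theorem functional_eq_zero (h : IsFourTermResolution f d₃ d₂ d₁ p)
    [Module.Projective (Λ ⊗[K] Λᵐᵒᵖ) P₃] [Module.Projective (Λ ⊗[K] Λᵐᵒᵖ) P₂]
    [Module.Projective (Λ ⊗[K] Λᵐᵒᵖ) P₁] [Module.Projective (Λ ⊗[K] Λᵐᵒᵖ) P₀]
    (hT : IsSymmetrizingTrace T) (hder : DerivationsInner ε' ε)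
    {π : A →ₐ[K] Λ} (hπ : Function.Surjective π) {R : Submodule K A}
    (hR : ∀ x ∈ R, ε (π x) = 0 ∧ ε' (π x) = 0) {φ : A →ₗ[K] K}
    (hφ : ∀ x r, π r = 0 → φ (x * r) = ε (π x) * φ r)
    (hφ' : ∀ r x, π r = 0 → φ (r * x) = φ r * ε' (π x))
    {ρ : A} (hρ : π ρ = 0) (hρR : ρ ∈ R * R) : φ ρ = 0 := by
  obtain ⟨z, hz⟩ := hT.exists_repr ε.toLinearMap
  obtain ⟨z', hz'⟩ := hT.exists_repr ε'.toLinearMap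
  replace hz : RepresentsChar T ε z := hz
  replace hz' : RepresentsChar T ε' z' := hz'
  obtain ⟨G, hG, hGp⟩ := h.exists_lift_zero ε
  obtain ⟨H, hHd, hH⟩ := h.exists_lift_one hπ hG hGp hφ
  obtain ⟨u, hu⟩ := h.surjective 1
  obtain ⟨w, hw⟩ := hπ (G u)
  -- On the second syzygy φ ∘ H is equivariant for χ, so it vanishes on ker χ times that syzygy.
  have hHsyz : ∀ x, d₁ x = 0 → (z ⊗ₜ[K] op z') • x = 0 → φ (H x) = 0 := by
    intro x hx hsx
    obtain ⟨n, hn, rfl⟩ := h.exists_sum_of_smul_eq_zero hT hz hz' hder hx hsx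
    rw [Finsupp.sum, map_sum, map_sum]
    refine Finset.sum_eq_zero fun y _ => ?_
    obtain ⟨a, ha⟩ := hπ (envRight ε (n y)).unop
    have hdy : d₁ (d₂ y) = 0 := (h.exact₁ _).2 ⟨y, rfl⟩
    rw [hH _ _ _ ha, hφ' _ _ (by rw [hHd, hdy, map_zero]), ha, char_unop_envRight, hn, mul_zero]
  have hdiff : ∀ a : Λ, ∃ y, d₁ y = (a ⊗ₜ[K] (1 : Λᵐᵒᵖ)) • u - ((1 : Λ) ⊗ₜ[K] op a) • u := by
    intro a
    refine (h.exact₀ _).1 ?_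
    rw [map_sub, ← op_one, h.aug_smul, h.aug_smul, hu]
    simp
  -- X bounds the commutator of π x with the lift `u` of 1; a factorization in R · R makes it
  -- possible to choose X killed by s.
  have key : ∀ x ∈ R * R, ∃ X, d₁ X = (π x ⊗ₜ[K] (1 : Λᵐᵒᵖ)) • u - ((1 : Λ) ⊗ₜ[K] op (π x)) • u ∧
      (z ⊗ₜ[K] op z') • X = 0 ∧ φ (H X) = - φ (w * x) := by
    intro x hx
    induction hx using Submodule.mul_induction_on' with
    | mem_mul_mem x hx y hy =>
      obtain ⟨X, hX⟩ := hdiff (π x)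
      obtain ⟨Y, hY⟩ := hdiff (π y)
      -- Leibniz rule. The outer factors π x and π y have character zero, so s kills both terms.
      refine ⟨(π x ⊗ₜ[K] (1 : Λᵐᵒᵖ)) • Y + ((1 : Λ) ⊗ₜ[K] op (π y)) • X, ?_, ?_, ?_⟩
      · rw [map_add, map_smul, map_smul, hX, hY, smul_sub, smul_sub, smul_smul, smul_smul,
          smul_smul, smul_smul]
        simp only [Algebra.TensorProduct.tmul_mul_tmul, one_mul, mul_one, map_mul, op_mul]
        abel
      · rw [smul_add, smul_smul, smul_smul, hT.env_mul_right hz hz', hT.env_mul_right hz hz']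
        simp only [envChar_tmul, (hR x hx).1, (hR y hy).2, unop_op, zero_mul, mul_zero]
        rw [zero_smul K]
        exact (congrArg₂ (· + ·) (zero_smul (Λ ⊗[K] Λᵐᵒᵖ) Y) (zero_smul (Λ ⊗[K] Λᵐᵒᵖ) X)).trans (add_zero 0)
      -- H X and -w x agree modulo ker π. Multiplying on the right by y ∈ R makes their difference
      -- invisible to φ.
      · have hr : π (H X + w * x) = 0 := by
          rw [map_add, hHd, hX, map_sub, hG, hG, map_mul, hw]
          simp [(hR x hx).1]
        have h2 := hφ' _ y hr
        rw [(hR y hy).2, mul_zero, add_mul, map_add, mul_assoc] at h2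
        rw [map_add, map_add, hH _ _ 0 (by simp [(hR x hx).1]), hH _ X y (by simp), mul_zero,
          map_zero, zero_add]
        exact eq_neg_of_add_eq_zero_left h2
    | add x _ y _ hx hy =>
      obtain ⟨X, hX, hsX, hHX⟩ := hx
      obtain ⟨Y, hY, hsY, hHY⟩ := hy
      refine ⟨X + Y, ?_, by rw [smul_add, hsX, hsY, add_zero], ?_⟩
      · rw [map_add, hX, hY, map_add, op_add, TensorProduct.add_tmul, TensorProduct.tmul_add,
          add_smul, add_smul]
        abel
      · rw [map_add, map_add, hHX, hHY, mul_add, map_add, neg_add]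
  obtain ⟨X, hX, hsX, hHX⟩ := key ρ hρR
  -- As π ρ = 0, the commutator vanishes and X lies in the second syzygy.
  have h0 := hHsyz X (by rw [hX, hρ]; simp) hsX
  rw [hHX, hφ _ _ hρ, hw, hGp, hu, map_one, one_mul, neg_eq_zero] at h0
  exact h0

end IsFourTermResolution

end Resolution

/-! ### Algebras of period four -/

section Periodic

variable {K : Type*} [Field K] {Λ : Type*} [Ring Λ] [Algebra K Λ] {T : Λ →ₗ[K] K}
  {ε ε' : Λ →ₐ[K] K} {A : Type*} [Ring A] [Algebra K A]

theorem exact_subtype_comp_of_surjective {E L L' P P' : Type*} [Ring E] [AddCommGroup L]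
    [AddCommGroup L'] [AddCommGroup P] [AddCommGroup P'] [Module E L] [Module E L'] [Module E P]
    [Module E P'] {π : P →ₗ[E] L} {π' : P' →ₗ[E] L'} (e : L ≃ₗ[E] LinearMap.ker π')
    (hπ : Function.Surjective π) :
    Function.Exact ((LinearMap.ker π').subtype ∘ₗ e.toLinearMap ∘ₗ π) π' := by
  intro x
  constructor
  · intro hx
    obtain ⟨y, hy⟩ := hπ (e.symm ⟨x, hx⟩)
    exact ⟨y, by simp [hy]⟩
  · rintro ⟨y, rfl⟩
    exact (e (π y)).2

theorem Function.Exact.subtype_comp {E L' M P P' : Type*} [Ring E] [AddCommGroup L']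
    [AddCommGroup P] [AddCommGroup P'] [Module E L'] [Module E P] [Module E P']
    {L : Type*} [AddCommGroup L] [Module E L] {f : M → P} {π : P →ₗ[E] L} {π' : P' →ₗ[E] L'}
    (h : Function.Exact f π) (e : L ≃ₗ[E] LinearMap.ker π') :
    Function.Exact f ((LinearMap.ker π').subtype ∘ₗ e.toLinearMap ∘ₗ π) := by
  intro x
  rw [← h x]
  simp

/-- Splices the four short exact sequences given by Ω⁴(Λ) ≅ Λ into one four-term resolution. -/
theorem IsPeriodicAlg.functional_eq_zero (h : IsPeriodicAlg K Λ 4)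
    (hT : IsSymmetrizingTrace T) (hder : DerivationsInner ε' ε)
    {π : A →ₐ[K] Λ} (hπ : Function.Surjective π) {R : Submodule K A}
    (hR : ∀ x ∈ R, ε (π x) = 0 ∧ ε' (π x) = 0) {φ : A →ₗ[K] K}
    (hφ : ∀ x r, π r = 0 → φ (x * r) = ε (π x) * φ r)
    (hφ' : ∀ r x, π r = 0 → φ (r * x) = φ r * ε' (π x))
    {ρ : A} (hρ : π ρ = 0) (hρR : ρ ∈ R * R) : φ ρ = 0 := by
  let _ : Module (Λ ⊗[K] Λᵐᵒᵖ) Λ := TensorProduct.Algebra.module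
  have hsmul : ∀ a b x : Λ, (a ⊗ₜ[K] op b) • x = a * x * b := fun a b x => by
    rw [TensorProduct.Algebra.smul_def, mul_assoc]
    rfl
  obtain ⟨-, L₃, _, _, ⟨L₂, _, _, ⟨L₁, _, _, ⟨L₀, _, _, ⟨e₀⟩, h₀⟩, h₁⟩, h₂⟩, h₃⟩ := h.1
  obtain ⟨P₀, _, _, π₀, _, hπ₀, -, ⟨e₁⟩⟩ := h₀
  obtain ⟨P₁, _, _, π₁, _, hπ₁, -, ⟨e₂⟩⟩ := h₁
  obtain ⟨P₂, _, _, π₂, _, hπ₂, -, ⟨e₃⟩⟩ := h₂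
  obtain ⟨P₃, _, _, π₃, _, hπ₃, -, ⟨e₄⟩⟩ := h₃
  let f : Λ →ₗ[Λ ⊗[K] Λᵐᵒᵖ] P₃ := (LinearMap.ker π₃).subtype ∘ₗ e₄.toLinearMap
  let p : P₀ →ₗ[Λ ⊗[K] Λᵐᵒᵖ] Λ := e₀.toLinearMap ∘ₗ π₀
  have hf : Function.Exact f π₃ := exact_subtype_comp_of_surjective (π := LinearMap.id) e₄
    Function.surjective_id
  have hres : IsFourTermResolution f.toAddMonoidHom
      ((LinearMap.ker π₂).subtype ∘ₗ e₃.toLinearMap ∘ₗ π₃)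
      ((LinearMap.ker π₁).subtype ∘ₗ e₂.toLinearMap ∘ₗ π₂)
      ((LinearMap.ker π₀).subtype ∘ₗ e₁.toLinearMap ∘ₗ π₁) p.toAddMonoidHom :=
    { bimodMap := ⟨fun a x => by
          have := map_smul f (a ⊗ₜ[K] op 1) x
          rwa [hsmul, mul_one] at this, fun x b => by
          have := map_smul f (1 ⊗ₜ[K] op b) x
          rwa [hsmul, one_mul] at this⟩
      injective := (LinearMap.ker π₃).injective_subtype.comp e₄.injective
      exact₃ := hf.subtype_comp e₃
      exact₂ := (exact_subtype_comp_of_surjective e₃ hπ₃).subtype_comp e₂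
      exact₁ := (exact_subtype_comp_of_surjective e₂ hπ₂).subtype_comp e₁
      exact₀ := fun x => by
        rw [← exact_subtype_comp_of_surjective e₁ hπ₁ x]
        exact e₀.map_eq_zero_iff
      surjective := e₀.surjective.comp hπ₀
      aug_smul := fun a b x => (map_smul p (a ⊗ₜ[K] op b) x).trans (hsmul _ _ _) }
  exact hres.functional_eq_zero hT hder hπ hR hφ hφ' hρ hρR

end Periodic

/-! ### Characters of path algebras -/

namespace PathAlgebra

variable {K : Type*} [Field K] {V : Type*} [Quiver V]

variable (K) in
/-- The trivial path at a vertex. -/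
noncomputable def idem (k : V) : PathAlgebra K V := ofPath K (Quiver.Path.nil : Quiver.Path k k)

open Classical in
variable (K) in
/-- The coefficient of the trivial path at `k`, as a linear form. -/
noncomputable def vertexForm (k : V) : PathAlgebra K V →ₗ[K] K :=
  Finsupp.linearCombination K fun q : QPath V => if q.1 = k ∧ q.2.2.length = 0 then (1 : K) else 0

open Classical in
theorem vertexForm_ofPath (k : V) {a b : V} (p : Quiver.Path a b) :
    vertexForm K k (ofPath K p) = if a = k ∧ p.length = 0 then 1 else 0 := by
  rw [vertexForm, ofPath]
  erw [Finsupp.linearCombination_single, one_smul]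

/-- A product of two paths is the trivial path at k only when both factors are. -/
theorem vertexForm_mul (k : V) (x y : PathAlgebra K V) :
    vertexForm K k (x * y) = vertexForm K k x * vertexForm K k y := by
  classical
  refine induction_on (P := fun x => vertexForm K k (x * y) = vertexForm K k x * vertexForm K k y)
    x (by simp only [zero_mul_aux, map_zero, zero_mul]) ?_ ?_
  · intro x x' h h'
    rw [add_mul_aux, map_add, h, h', map_add, add_mul]
  intro c a b p
  refine induction_on (P := fun y => vertexForm K k (c • ofPath K p * y) =
    vertexForm K k (c • ofPath K p) * vertexForm K k y)
    y (by simp only [mul_zero_aux, map_zero, mul_zero]) ?_ ?_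
  · intro x x' h h'
    rw [mul_add_aux, map_add, h, h', map_add, mul_add]
  intro c' a' b' p'
  rw [smul_mul_aux, mul_smul_aux, map_smul, map_smul, map_smul, map_smul, smul_mul_smul_comm,
    smul_smul]
  congr 1
  by_cases hb : b = a'
  · subst hb
    rw [ofPath_mul_comp, vertexForm_ofPath, vertexForm_ofPath, vertexForm_ofPath,
      Quiver.Path.length_comp]
    by_cases hp : p.length = 0
    · obtain rfl := Quiver.Path.eq_of_length_zero p hp
      by_cases ha : a = k <;> simp [hp, ha]
    · simp [hp]
  · rw [ofPath_mul_of_ne _ _ hb, map_zero, vertexForm_ofPath, vertexForm_ofPath]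
    by_cases hp : p.length = 0
    · obtain rfl := Quiver.Path.eq_of_length_zero p hp
      by_cases ha : a = k
      · subst ha
        simp [Ne.symm hb]
      · simp [ha]
    · simp [hp]

theorem vertexForm_idem_self (k : V) : vertexForm K k (idem K k) = 1 := by
  rw [idem, vertexForm_ofPath]
  simp

theorem vertexForm_idem_of_ne {k l : V} (h : l ≠ k) : vertexForm K k (idem K l) = 0 := by
  rw [idem, vertexForm_ofPath]
  simp [h]

theorem vertexForm_of_mem_arrowIdeal (k : V) {x : PathAlgebra K V} (hx : x ∈ arrowIdeal K V) :
    vertexForm K k x = 0 := by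
  refine Submodule.span_induction (p := fun x _ => vertexForm K k x = 0) ?_ (map_zero _) ?_ ?_ hx
  · rintro _ ⟨a, b, p, hp, rfl⟩
    rw [vertexForm_ofPath, if_neg fun h => by omega]
  · intro x y _ _ hx hy
    rw [map_add, hx, hy, add_zero]
  · intro c x _ hx
    rw [map_smul, hx, smul_zero]

theorem ofPath_mem_arrowIdeal {a b : V} (p : Quiver.Path a b) (hp : 1 ≤ p.length) :
    ofPath K p ∈ arrowIdeal K V :=
  Submodule.subset_span ⟨a, b, p, hp, rfl⟩

theorem idem_mul_ofPath {a b : V} (p : Quiver.Path a b) : idem K a * ofPath K p = ofPath K p := by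
  rw [idem, ofPath_mul_comp, Quiver.Path.nil_comp]

theorem ofPath_mul_idem {a b : V} (p : Quiver.Path a b) : ofPath K p * idem K b = ofPath K p := by
  rw [idem, ofPath_mul_comp, Quiver.Path.comp_nil]

theorem idem_mul_sub_mem (k : V) (x : PathAlgebra K V) :
    idem K k * x - vertexForm K k x • idem K k ∈ arrowIdeal K V := by
  refine induction_on (P := fun x => idem K k * x - vertexForm K k x • idem K k ∈ arrowIdeal K V)
    x (by simp only [mul_zero_aux, map_zero, zero_smul, sub_zero, zero_mem]) ?_ ?_
  · intro x y hx hy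
    rw [mul_add_aux, map_add, add_smul, add_sub_add_comm]
    exact add_mem hx hy
  · intro c a b p
    rw [mul_smul_aux, map_smul, smul_assoc, ← smul_sub]
    refine Submodule.smul_mem _ _ ?_
    by_cases ha : a = k
    · subst ha
      rw [idem_mul_ofPath, vertexForm_ofPath]
      by_cases hp : p.length = 0
      · obtain rfl := Quiver.Path.eq_of_length_zero p hp
        obtain rfl := Quiver.Path.eq_nil_of_length_zero p hp
        simp [idem]
      · simpa [hp] using ofPath_mem_arrowIdeal p (by omega)
    · rw [idem, ofPath_mul_of_ne _ _ (Ne.symm ha), vertexForm_ofPath]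
      simp [ha]

theorem mul_idem_sub_mem (k : V) (x : PathAlgebra K V) :
    x * idem K k - vertexForm K k x • idem K k ∈ arrowIdeal K V := by
  refine induction_on (P := fun x => x * idem K k - vertexForm K k x • idem K k ∈ arrowIdeal K V)
    x (by simp only [zero_mul_aux, map_zero, zero_smul, sub_zero, zero_mem]) ?_ ?_
  · intro x y hx hy
    rw [add_mul_aux, map_add, add_smul, add_sub_add_comm]
    exact add_mem hx hy
  · intro c a b p
    rw [smul_mul_aux, map_smul, smul_assoc, ← smul_sub]
    refine Submodule.smul_mem _ _ ?_
    by_cases hb : b = k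
    · subst hb
      rw [ofPath_mul_idem, vertexForm_ofPath]
      by_cases hp : p.length = 0
      · obtain rfl := Quiver.Path.eq_of_length_zero p hp
        obtain rfl := Quiver.Path.eq_nil_of_length_zero p hp
        simp [idem]
      · simpa [hp] using ofPath_mem_arrowIdeal p (by omega)
    · rw [idem, ofPath_mul_of_ne _ _ hb, vertexForm_ofPath, if_neg]
      · simp
      · rintro ⟨rfl, hp⟩
        exact hb (Quiver.Path.eq_of_length_zero p hp).symm

theorem idem_mul_mul_idem_of_support {a b : V} {x : PathAlgebra K V}
    (hx : ∀ (c d : V) (p : Quiver.Path c d), x.coeff p ≠ 0 → c = a ∧ d = b) :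
    idem K a * x * idem K b = x := by
  have hsum : x = ∑ q ∈ Finsupp.support (M := K) x, x.coeff q.2.2 • ofPath K q.2.2 := by
    conv_lhs => rw [← Finsupp.sum_single (M := K) x]
    refine Finset.sum_congr rfl fun q _ => ?_
    rw [ofPath]
    erw [Finsupp.smul_single, smul_eq_mul, mul_one]
    rfl
  conv_lhs => rw [hsum]
  conv_rhs => rw [hsum]
  rw [mul_sum_aux, sum_mul_aux]
  refine Finset.sum_congr rfl ?_
  rintro ⟨c, d, p⟩ hq
  obtain ⟨rfl, rfl⟩ := hx c d p (Finsupp.mem_support_iff.1 hq)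
  rw [mul_smul_aux, smul_mul_aux, idem_mul_ofPath, ofPath_mul_idem]

variable [Fintype V]

variable (K) in
/-- The character of the path algebra given by a vertex. -/
noncomputable def vertexChar (k : V) : PathAlgebra K V →ₐ[K] K :=
  AlgHom.ofLinearMap (vertexForm K k) (by
    classical
    change vertexForm K k (∑ a : V, idem K a) = 1
    rw [map_sum, Finset.sum_eq_single k, vertexForm_idem_self]
    · intro l _ hl
      exact vertexForm_idem_of_ne hl
    · simp) (vertexForm_mul k)

/-- If there is no arrow from `j` to `i`, then every derivation of the path algebra with values in
the one-dimensional bimodule with characters `j`, `i` is inner. -/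
theorem derivation_eq_inner {i j : V} (hij : IsEmpty (j ⟶ i)) {g : PathAlgebra K V →ₗ[K] K}
    (hg : ∀ x y, g (x * y) = vertexForm K j x * g y + vertexForm K i y * g x)
    (x : PathAlgebra K V) : g x = g (idem K j) * (vertexForm K j x - vertexForm K i x) := by
  refine induction_on (P := fun x => g x = g (idem K j) * (vertexForm K j x - vertexForm K i x))
    x (by simp only [map_zero, sub_zero, mul_zero]) ?_ ?_
  · intro x y hx hy
    rw [map_add, hx, hy, map_add, map_add]
    ring
  intro c a b p
  rw [map_smul, map_smul, map_smul, ← smul_sub, mul_smul_comm]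
  congr 1
  cases p with
  | nil =>
    change g (idem K a) = g (idem K j) * (vertexForm K j (idem K a) - vertexForm K i (idem K a))
    have h := hg (idem K a) (idem K a)
    rw [show idem K a * idem K a = idem K a from idem_mul_ofPath _] at h
    by_cases haj : a = j
    · subst haj
      by_cases hai : a = i
      · subst hai
        rw [vertexForm_idem_self] at h ⊢
        linear_combination -h
      · rw [vertexForm_idem_self, vertexForm_idem_of_ne hai]
        ring
    · rw [vertexForm_idem_of_ne haj] at h ⊢
      by_cases hai : a = i
      · subst hai
        have h' := hg (idem K j) (idem K a)
        rw [show idem K j * idem K a = 0 from ofPath_mul_of_ne _ _ (Ne.symm haj), map_zero,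
          vertexForm_idem_self, vertexForm_idem_self] at h'
        rw [vertexForm_idem_self]
        linear_combination -h'
      · rw [vertexForm_idem_of_ne hai] at h ⊢
        rw [h]
        ring
  | cons q α =>
    rename_i d
    rw [vertexForm_of_mem_arrowIdeal j (ofPath_mem_arrowIdeal _ (by simp)),
      vertexForm_of_mem_arrowIdeal i (ofPath_mem_arrowIdeal _ (by simp)), sub_zero, mul_zero]
    have hα : ∀ k, vertexForm K k (ofPath K α.toPath) = 0 := fun k =>
      vertexForm_of_mem_arrowIdeal k (ofPath_mem_arrowIdeal _ (by simp))
    have hcons : ofPath K (q.cons α) = ofPath K q * ofPath K α.toPath := by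
      rw [ofPath_mul_comp]
      rfl
    classical
    -- Only paths with q trivial at j can contribute, that is, arrows starting at j; such an arrow
    -- does not end at i.
    rw [hcons, hg, hα, zero_mul, add_zero, mul_eq_zero, or_iff_not_imp_left]
    intro hq
    rw [vertexForm_ofPath, ite_eq_right_iff, Classical.not_imp] at hq
    obtain ⟨⟨rfl, hq⟩, -⟩ := hq
    obtain rfl := Quiver.Path.eq_of_length_zero q hq
    have hbi : b ≠ i := by
      rintro rfl
      exact hij.false α
    have h := hg (ofPath K α.toPath) (idem K b)
    rwa [ofPath_mul_idem, hα, zero_mul, vertexForm_idem_of_ne hbi, zero_mul, add_zero] at h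

end PathAlgebra

/-! ### Minimal relations of symmetric algebras of period four -/

open PathAlgebra in
/-- In a symmetric algebra of period four, a minimal relation from `a` to `b` forces an arrow from
`b` to `a`. -/
theorem IsMinimalRelation.nonempty_hom {K : Type*} [Field K] {V : Type*} [Quiver V] [Fintype V]
    {I : Ideal (PathAlgebra K V)} [I.IsTwoSided]
    (hI : I.restrictScalars K ≤ arrowIdeal K V ^ 2)
    (hsymm : IsSymmetricAlg K (PathAlgebra K V ⧸ I))
    (hper : IsPeriodicAlg K (PathAlgebra K V ⧸ I) 4) {a b : V} {ρ : PathAlgebra K V}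
    (hρ : IsMinimalRelation I a b ρ) : Nonempty (b ⟶ a) := by
  obtain ⟨hρI, hρab, hρmin⟩ := hρ
  by_contra hba
  rw [not_nonempty_iff] at hba
  obtain ⟨T, hT⟩ := hsymm.exists_isSymmetrizingTrace
  let π : PathAlgebra K V →ₐ[K] PathAlgebra K V ⧸ I := Ideal.Quotient.mkₐ K I
  have hπ : Function.Surjective π := Ideal.Quotient.mkₐ_surjective K I
  have hπI : ∀ {x}, π x = 0 ↔ x ∈ I := fun {x} => Ideal.Quotient.eq_zero_iff_mem
  have hIR : ∀ x ∈ I, x ∈ arrowIdeal K V * arrowIdeal K V := fun x hx => by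
    rw [← pow_two]
    exact hI hx
  have hIε : ∀ k, ∀ x ∈ I, vertexChar K k x = 0 := by
    intro k x hx
    change vertexForm K k x = 0
    refine Submodule.mul_induction_on (hIR x hx) (fun y hy _ _ => ?_) fun y y' hy hy' => ?_
    · rw [vertexForm_mul, vertexForm_of_mem_arrowIdeal k hy, zero_mul]
    · rw [map_add, hy, hy', add_zero]
  let ε : V → (PathAlgebra K V ⧸ I →ₐ[K] K) := fun k =>
    Ideal.Quotient.liftₐ I (vertexChar K k) (hIε k)
  have hε : ∀ k x, ε k (π x) = vertexForm K k x := fun k x => rfl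
  -- The characters appear in reversed order, so the obstruction is exactly an arrow from b to a.
  have hder : DerivationsInner (ε b) (ε a) := by
    intro g hg
    refine ⟨g (π (idem K b)), fun x => ?_⟩
    obtain ⟨x, rfl⟩ := hπ x
    refine derivation_eq_inner hba (g := g ∘ₗ π.toLinearMap) (fun x y => ?_) x
    have := hg (π x) (π y)
    rwa [← map_mul] at this
  obtain ⟨φ, hφρ, hφ⟩ := Submodule.exists_le_ker_of_notMem hρmin
  -- Cutting φ by the idempotents at a and b makes it equivariant on I: modulo R, multiplication by
  -- x next to an idempotent is a scalar, and φ kills IR + RI.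
  let ψ : PathAlgebra K V →ₗ[K] K :=
    φ ∘ₗ LinearMap.mulRight K (idem K b) ∘ₗ LinearMap.mulLeft K (idem K a)
  have hψ : ∀ x, ψ x = φ (idem K a * x * idem K b) := fun x => rfl
  have hφIR : ∀ r ∈ I, ∀ x ∈ arrowIdeal K V, φ (r * x) = 0 := fun r hr x hx =>
    hφ (Submodule.mem_sup_left (Submodule.mul_mem_mul hr hx))
  have hφRI : ∀ x ∈ arrowIdeal K V, ∀ r ∈ I, φ (x * r) = 0 := fun x hx r hr =>
    hφ (Submodule.mem_sup_right (Submodule.mul_mem_mul hx hr))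
  refine hφρ ?_
  rw [← idem_mul_mul_idem_of_support hρab, ← hψ]
  refine hper.functional_eq_zero (R := arrowIdeal K V) hT hder hπ (fun x hx => ?_) (fun x r hr => ?_)
    (fun r x hr => ?_) (hπI.2 hρI) (hIR ρ hρI)
  · rw [hε, hε]
    exact ⟨vertexForm_of_mem_arrowIdeal a hx, vertexForm_of_mem_arrowIdeal b hx⟩
  · have h := hφRI _ (idem_mul_sub_mem a x) _ (I.mul_mem_right (idem K b) (hπI.1 hr))
    rw [sub_mul, map_sub, smul_mul_assoc, map_smul, sub_eq_zero, ← mul_assoc, ← mul_assoc] at h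
    rw [hψ, hψ, hε, ← mul_assoc, h, smul_eq_mul]
  · have h := hφIR _ (I.mul_mem_left (idem K a) (hπI.1 hr)) _ (mul_idem_sub_mem b x)
    rw [mul_sub, map_sub, mul_smul_comm, map_smul, sub_eq_zero] at h
    rw [hψ, hψ, hε, ← mul_assoc, mul_assoc, h, smul_eq_mul, mul_comm]

theorem lemma4p5 {K : Type*} [Field K] [IsAlgClosed K] {V : Type*} [Quiver V] [Fintype V]
    (hconn : QuiverConnected V) (hbis : QuiverBiserial V)
    (I : Ideal (PathAlgebra K V)) [I.IsTwoSided] (hI : IsAdmissible I)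
    (hΛ : IsTSP4 K (PathAlgebra K V ⧸ I))
    {u i k t j : V} (δ : u ⟶ i) (α : i ⟶ k) (β : k ⟶ t) (γ : t ⟶ j)
    (h₂ : ¬ OccursInMinimalRelation I (α.toPath.comp β.toPath) ∨
      ¬ OccursInMinimalRelation I (β.toPath.comp γ.toPath))
    (h₃ : OccursInMinimalRelation I ((α.toPath.comp β.toPath).comp γ.toPath)) :
    Nonempty (j ⟶ i) := by
  obtain ⟨ρ, hρ, -⟩ := h₃
  exact hρ.nonempty_hom hI.1 hΛ.symmetric hΛ.periodic
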